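/- A modal algebra is a Boolean algebra $B$ with an operator $\Diamond:B\to B$ such that $\Diamond(a\vee b)=\Diamond a\vee\Diamond b$ and $\Diamond\bot=\bot$; $\mathbf{MA}$ is the category of modal algebras and Boolean homomorphisms commuting with $\Diamond$, and $\mathbf{MA}_f$ is its full subcategory of finite modal algebras. $\mathbf{CAMA}_\infty$ is the category of modal algebras that are complete and atomic and whose $\Diamond$ preserves arbitrary joins, with the morphisms of $\mathbf{MA}$ that preserve arbitrary joins and meets. A profinite modal algebra is an object of $\mathbf{CAMA}_\infty$ that is the limit, in $\mathbf{CAMA}_\infty$, of a small cofiltered diagram of finite modal algebras; $\mathrm{Pro}\,\mathbf{MA}_f$ is the full subcategory of $\mathbf{CAMA}_\infty$ on these objects. Let $\iota:\mathrm{Pro}\,\mathbf{MA}_f\hookrightarrow\mathbf{MA}$ be the (faithful) inclusion and $\iota_f:\mathbf{MA}_f\hookrightarrow\mathbf{MA}$ its restriction. For a modal algebra $A$ let $\pi:A\downarrow\iota_f\to\mathrm{Pro}\,\mathbf{MA}_f$ be the diagram sending a finite $A$-model $A\to\iota_f(C)$ to $C$, and let $J_A\subseteq A\downarrow\iota_f$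 be the full subcategory of those $A\to\iota_f(C)$ that are surjective as functions. **Theorem.** (0) $\mathrm{Pro}\,\mathbf{MA}_f$ is the pro-completion of $\mathbf{MA}_f$: there is an equivalence $\mathrm{Pro}\,\mathbf{MA}_f\simeq(\mathrm{Ind}(\mathbf{MA}_f^{op}))^{op}$ under which the embedding of $\mathbf{MA}_f$ corresponds, up to natural isomorphism, to the Yoneda embedding. (1) The inclusion $\iota:\mathrm{Pro}\,\mathbf{MA}_f\to\mathbf{MA}$ has a left adjoint $\mathrm{PrC}$. (2) For every modal algebra $A$, the limit $\varprojlim\pi$ exists in $\mathrm{Pro}\,\mathbf{MA}_f$ and is preserved by $\iota$, that is, $\iota(\varprojlim\pi)\cong\varprojlim\iota\pi$. The category $J_A$ is cofiltered and its inclusion into $A\downarrow\iota_f$ is initial, so that $\varprojlim\pi$ is also the limit of the restriction of $\pi$ to $J_A$. (3) For every left adjoint $\mathrm{PrC}$ of $\iota$ and every modal algebra $A$ there is an isomorphism $\mathrm{PrC}(A)\cong\varprojlim\pi$ in $\mathrm{Pro}\,\mathbf{MA}_f$ whose image under $\iota$ carries the unit $A\to\iota(\mathrm{PrC}(A))$ of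 the adjunction $\mathrm{PrC}\dashv\iota$ to the canonical morphism $A\to\iota(\varprojlim\pi)\cong\varprojlim\iota\pi$, namely the one whose component at a finite $A$-model $f:A\to\iota_f(C)$ is $f$. -/

import Mathlib

open CategoryTheory CategoryTheory.Limits

universe u

/-- A modal algebra: a Boolean algebra with an operator `dia` preserving finite joins. -/
structure ModalAlg : Type (u + 1) where
  carrier : Type u
  [str : BooleanAlgebra carrier]
  dia : carrier → carrier
  dia_sup : ∀ a b : carrier, dia (a ⊔ b) = dia a ⊔ dia b
  dia_bot : dia ⊥ = ⊥

namespace ModalAlg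

instance : CoeSort ModalAlg.{u} (Type u) := ⟨ModalAlg.carrier⟩

instance (A : ModalAlg.{u}) : BooleanAlgebra A := A.str

/-- Morphisms of modal algebras: Boolean homomorphisms commuting with `dia`. -/
@[ext]
structure Hom (A B : ModalAlg.{u}) : Type u where
  toBool : BoundedLatticeHom A B
  map_dia : ∀ a : A, toBool (A.dia a) = B.dia (toBool a)

/-- The category **MA** of modal algebras. -/
instance : Category.{u} ModalAlg.{u} where
  Hom A B := Hom A B
  id A := ⟨BoundedLatticeHom.id A, fun _ => rfl⟩
  comp f g := ⟨g.toBool.comp f.toBool, fun a => by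
    simp [BoundedLatticeHom.comp_apply, f.map_dia, g.map_dia]⟩

/-- The function underlying a morphism of modal algebras. -/
def fn {A B : ModalAlg.{u}} (f : A ⟶ B) : A → B := Hom.toBool f

/-- `A` is complete and atomic, and `dia` preserves arbitrary joins. -/
def IsCAMA : ObjectProperty ModalAlg.{u} := fun A =>
  (∀ S : Set A, ∃ a : A, IsLUB S a) ∧ IsAtomic A ∧
    ∀ (S : Set A) (a : A), IsLUB S a → IsLUB (A.dia '' S) (A.dia a)

/-- `f` preserves arbitrary joins and meets. -/
def IsComplete {A B : ModalAlg.{u}} (f : A ⟶ B) : Prop :=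
  ∀ (S : Set A) (a : A), (IsLUB S a → IsLUB (fn f '' S) (fn f a)) ∧
    (IsGLB S a → IsGLB (fn f '' S) (fn f a))

lemma isComplete_id (A : ModalAlg.{u}) : IsComplete (𝟙 A) := fun S a => by
  have h : fn (𝟙 A) = id := rfl
  simp [h]

lemma IsComplete.comp {A B C : ModalAlg.{u}} {f : A ⟶ B} {g : B ⟶ C}
    (hf : IsComplete f) (hg : IsComplete g) : IsComplete (f ≫ g) := fun S a => by
  have h : fn (f ≫ g) = fn g ∘ fn f := rfl
  rw [h, Set.image_comp]
  exact ⟨fun hS => (hg _ _).1 ((hf _ _).1 hS), fun hS => (hg _ _).2 ((hf _ _).2 hS)⟩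

lemma isLUB_image_of_finite {α β : Type u} [BooleanAlgebra α] [BooleanAlgebra β]
    (f : SupBotHom α β) {S : Set α} (hS : S.Finite) {a : α} (h : IsLUB S a) :
    IsLUB (f '' S) (f a) := by
  classical
  obtain ⟨s, rfl⟩ := hS.exists_finset_coe
  have ha : s.sup id = a := IsLUB.unique (Finset.isLUB_sup_id) h
  rw [← ha, map_finset_sup, ← Finset.coe_image]
  have := Finset.isLUB_sup_id (s := s.image f)
  rwa [Finset.sup_image] at this

lemma isGLB_image_of_finite {α β : Type u} [BooleanAlgebra α] [BooleanAlgebra β]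
    (f : InfTopHom α β) {S : Set α} (hS : S.Finite) {a : α} (h : IsGLB S a) :
    IsGLB (f '' S) (f a) := by
  classical
  obtain ⟨s, rfl⟩ := hS.exists_finset_coe
  have ha : s.inf id = a := IsGLB.unique (Finset.isGLB_inf_id) h
  rw [← ha, map_finset_inf, ← Finset.coe_image]
  have := Finset.isGLB_inf_id (s := s.image f)
  rwa [Finset.inf_image] at this

lemma isCAMA_of_finite (A : ModalAlg.{u}) [Finite A] : IsCAMA A := by
  refine ⟨fun S => ?_, inferInstance, fun S a h => ?_⟩
  · obtain ⟨s, rfl⟩ := S.toFinite.exists_finset_coe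
    exact ⟨_, Finset.isLUB_sup_id⟩
  · exact isLUB_image_of_finite
      (⟨⟨A.dia, A.dia_sup⟩, A.dia_bot⟩ : SupBotHom A A) S.toFinite h

lemma isComplete_of_finite {A B : ModalAlg.{u}} [Finite A] (f : A ⟶ B) : IsComplete f :=
  fun S _ =>
    ⟨fun h => isLUB_image_of_finite
      (⟨⟨fn f, map_sup (Hom.toBool f)⟩, map_bot (Hom.toBool f)⟩ : SupBotHom A B) S.toFinite h,
    fun h => isGLB_image_of_finite
      (⟨⟨fn f, map_inf (Hom.toBool f)⟩, map_top (Hom.toBool f)⟩ : InfTopHom A B) S.toFinite h⟩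

end ModalAlg

open ModalAlg

/-- The full subcategory **MA**_f of finite modal algebras. -/
abbrev FinModalAlg : Type (u + 1) :=
  ObjectProperty.FullSubcategory (fun A : ModalAlg.{u} => Finite A)

instance (A : FinModalAlg.{u}) : Finite A.obj := A.property

/-- Completely additive complete atomic modal algebras. -/
structure CAMA : Type (u + 1) where
  obj : ModalAlg.{u}
  property : IsCAMA obj

namespace CAMA

/-- Morphisms of modal algebras preserving arbitrary joins and meets. -/
@[ext]
structure Hom (A B : CAMA.{u}) : Type u where
  hom : A.obj ⟶ B.obj
  complete : IsComplete hom

/-- The category **CAMA**_∞. -/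
instance : Category.{u} CAMA.{u} where
  Hom A B := Hom A B
  id A := ⟨𝟙 A.obj, isComplete_id _⟩
  comp f g := ⟨f.hom ≫ g.hom, f.complete.comp g.complete⟩

/-- The (faithful, not full) inclusion of **CAMA**_∞ into **MA**. -/
def toMA : CAMA.{u} ⥤ ModalAlg.{u} where
  obj A := A.obj
  map f := Hom.hom f

end CAMA

/-- Finite modal algebras are completely additive complete atomic modal algebras, and all
morphisms between them are complete. -/
def FinModalAlg.toCAMA : FinModalAlg.{u} ⥤ CAMA.{u} where
  obj A := ⟨A.obj, isCAMA_of_finite A.obj⟩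
  map f := ⟨f.hom, isComplete_of_finite f.hom⟩

/-- A modal algebra in **CAMA**_∞ is profinite if it is, in **CAMA**_∞, the limit of a small
cofiltered diagram of finite modal algebras. -/
def IsProfiniteMA : ObjectProperty CAMA.{u} := fun B =>
  ∃ (J : Type u) (_ : SmallCategory J) (_ : IsCofiltered J) (F : J ⥤ FinModalAlg.{u})
    (c : Cone (F ⋙ FinModalAlg.toCAMA)), Nonempty (IsLimit c) ∧ c.pt = B

/-- The category of profinite modal algebras, a full subcategory of **CAMA**_∞. -/
abbrev ProMA : Type (u + 1) := IsProfiniteMA.{u}.FullSubcategory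

/-- The inclusion `ι` of profinite modal algebras into **MA**. -/
def ProMA.incl : ProMA.{u} ⥤ ModalAlg.{u} := IsProfiniteMA.ι ⋙ CAMA.toMA

lemma isProfiniteMA_of_finite (A : FinModalAlg.{u}) :
    IsProfiniteMA (FinModalAlg.toCAMA.obj A) := by
  let F : Discrete PUnit.{u + 1} ⥤ FinModalAlg.{u} := (Functor.const _).obj A
  let c : Cone (F ⋙ FinModalAlg.toCAMA) :=
    { pt := FinModalAlg.toCAMA.obj A, π := { app := fun _ => 𝟙 _ } }
  have hc : IsLimit c :=
    { lift := fun s => s.π.app ⟨PUnit.unit⟩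
      fac := fun s j => Category.comp_id _
      uniq := fun s m hm => (Category.comp_id m).symm.trans (hm ⟨PUnit.unit⟩) }
  exact ⟨Discrete PUnit.{u + 1}, inferInstance, inferInstance, F, c, ⟨hc⟩, rfl⟩

/-- The full embedding of finite modal algebras into profinite modal algebras. -/
def FinModalAlg.toPro : FinModalAlg.{u} ⥤ ProMA.{u} :=
  IsProfiniteMA.lift FinModalAlg.toCAMA isProfiniteMA_of_finite

/-- The restriction `ι_f` of `ι` to the finite modal algebras. -/
abbrev FinModalAlg.incl : FinModalAlg.{u} ⥤ ModalAlg.{u} := FinModalAlg.toPro ⋙ ProMA.incl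

namespace ModalAlg

/-- The category `A ↓ ι_f` of finite `A`-models. -/
abbrev FiniteModel (A : ModalAlg.{u}) : Type (u + 1) := StructuredArrow A FinModalAlg.incl.{u}

/-- The finite `A`-models `A ⟶ ι_f C` that are surjective as functions. -/
def IsIrreducible (A : ModalAlg.{u}) : ObjectProperty (FiniteModel A) :=
  fun X => Function.Surjective (fn X.hom)

/-- The diagram of finite `A`-models, sending `A ⟶ ι_f C` to `C`. -/
abbrev modelDiagram (A : ModalAlg.{u}) : FiniteModel A ⥤ ProMA.{u} :=
  StructuredArrow.proj A FinModalAlg.incl ⋙ FinModalAlg.toPro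

/-- The tautological cone from `A` to the diagram of finite `A`-models in **MA**, with component
`f` at `f : A ⟶ ι_f C`. -/
def modelCone (A : ModalAlg.{u}) : Cone (modelDiagram A ⋙ ProMA.incl) where
  pt := A
  π :=
    { app := fun X => X.hom
      naturality := fun _ _ g => (Category.id_comp _).trans (StructuredArrow.w g).symm }

end ModalAlg

-- Limits in `CAMA` are algebras of compatible families with pointwise operations
-- (`CAMA.isConcreteLimit_of_isLimit`), so they are also limits in **MA**. The central fact is that
-- finite algebras are cocompact: a complete morphism from a cofiltered limit of finite algebras to
-- a finite one factors through a projection (`CAMA.IsConcreteLimit.exists_factorization`). The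
-- pro-completion statement is then the dual of a recognition criterion for ind-completions
-- (`Functor.IsCompactValued.exists_equivalence_ind`).
--
-- For the adjunction, replacing a finite model by the image of `A` shows that the surjective models
-- form a thin, cofiltered, essentially small initial subcategory. Hence the limit of all finite
-- models is a small cofiltered limit of finite algebras, so it exists and is preserved by `ι`.
--
-- A morphism from `A` to a profinite algebra is a compatible family of finite models, so it extends
-- to that limit. The extension is unique: composed with a projection to a finite algebra, any two
-- extensions factor through one surjective model by cocompactness, and there they are determined by
-- their restriction to `A` (`existsUnique_lift`). So the map from `A` to the limit is a universal
-- arrow to `ι`.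

universe v u₁ u₂

open Opposite

namespace CategoryTheory

/-! ### A recognition criterion for ind-completions. -/

section IndCompletion

variable {C : Type u₁} [Category.{v} C] {D : Type u₂} [Category.{v} D] (K : C ⥤ D)

/-- Every object `K.obj X` is compact with respect to small filtered colimits of objects in the
image of `K`. -/
structure Functor.IsCompactValued : Prop where
  exists_factorization : ∀ {J : Type v} [SmallCategory J] [IsFiltered J] {F : J ⥤ C}
    {c : Cocone (F ⋙ K)}, IsColimit c → ∀ {X : C} (h : K.obj X ⟶ c.pt),
      ∃ (j : J) (g : X ⟶ F.obj j), K.map g ≫ c.ι.app j = h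
  exists_comp_eq : ∀ {J : Type v} [SmallCategory J] [IsFiltered J] {F : J ⥤ C}
    {c : Cocone (F ⋙ K)}, IsColimit c → ∀ {X : C} {j : J} {f g : X ⟶ F.obj j},
      K.map f ≫ c.ι.app j = K.map g ≫ c.ι.app j →
        ∃ (k : J) (t : j ⟶ k), f ≫ F.map t = g ≫ F.map t

variable {K}

namespace Functor.IsCompactValued

variable (hK : K.IsCompactValued)
include hK

section

variable {J : Type v} [SmallCategory J] [IsFiltered J] {F : J ⥤ C} {c : Cocone (F ⋙ K)}

/-- A cocone, as a functor to the category of arrows from values of `K` to its point. -/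
abbrev _root_.CategoryTheory.Limits.Cocone.toValues (c : Cocone (F ⋙ K)) :
    J ⥤ CostructuredArrow K c.pt :=
  c.toCostructuredArrow ⋙ CostructuredArrow.pre F K c.pt

/-- Over a filtered source, finality means that every object maps to a value and that parallel maps
to a value get equalized later on. These are the two compactness conditions. -/
lemma final_toValues [K.Full] [K.Faithful] (hc : IsColimit c) : c.toValues.Final := by
  refine Functor.final_of_exists_of_isFiltered _ (fun X => ?_) fun {X j} s s' => ?_
  · obtain ⟨j, g, hg⟩ := hK.exists_factorization hc X.hom
    exact ⟨j, ⟨CostructuredArrow.homMk g hg⟩⟩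
  · obtain ⟨k, t, ht⟩ := hK.exists_comp_eq hc (f := s.left) (g := s'.left)
      ((CostructuredArrow.w s).trans (CostructuredArrow.w s').symm)
    exact ⟨k, t, CostructuredArrow.hom_ext _ _ ht⟩

/-- The restricted Yoneda functor preserves filtered colimits of values of `K`. -/
noncomputable def isColimitMapCocone [K.Full] [K.Faithful] (hc : IsColimit c) :
    IsColimit ((Presheaf.restrictedULiftYoneda.{v} K).mapCocone c) := by
  -- A filtered colimit of sets is recognized by its elements: each comes from some stage, and two
  -- that become equal in it are equal at a later stage.
  refine evaluationJointlyReflectsColimits _ fun X =>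
    Types.FilteredColimit.isColimitOf' _ _ (fun x => ?_) fun j x y hxy => ?_
  · obtain ⟨j, g, hg⟩ := hK.exists_factorization hc (X := X.unop) x.down
    exact ⟨j, ⟨K.map g⟩, congrArg ULift.up hg.symm⟩
  · obtain ⟨f, hf⟩ := K.map_surjective x.down
    obtain ⟨g, hg⟩ := K.map_surjective y.down
    have h : x.down ≫ c.ι.app j = y.down ≫ c.ι.app j := congrArg ULift.down hxy
    rw [← hf, ← hg] at h
    obtain ⟨k, t, ht⟩ := hK.exists_comp_eq hc h
    refine ⟨k, t, congrArg ULift.up ?_⟩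
    change x.down ≫ K.map (F.map t) = y.down ≫ K.map (F.map t)
    rw [← hf, ← hg, ← K.map_comp, ht, K.map_comp]

end

variable [K.Full] [K.Faithful]
  (hpres : ∀ d : D, ∃ (J : Type v) (_ : SmallCategory J) (_ : IsFiltered J) (F : J ⥤ C)
    (c : Cocone (F ⋙ K)) (_ : IsColimit c), c.pt = d)
include hpres

/-- The canonical cocone on `d` restricts along the final functor `toValues` to the given colimit
presentation, so it is itself a colimit. -/
lemma isDense : K.IsDense where
  isDenseAt d := by
    obtain ⟨J, _, _, F, c, hc, rfl⟩ := hpres d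
    have := hK.final_toValues hc
    exact ⟨Functor.Final.isColimitWhiskerEquiv c.toValues _
      (IsColimit.ofIsoColimit hc (Cocone.ext (Iso.refl _)
        fun _ => (Category.comp_id _).trans (Category.id_comp _).symm))⟩

end Functor.IsCompactValued

/-- A fully faithful functor composed with its restricted Yoneda functor is the Yoneda
embedding. -/
noncomputable def compRestrictedULiftYonedaIso (K : C ⥤ D) [K.Full] [K.Faithful] :
    K ⋙ Presheaf.restrictedULiftYoneda.{v} K ≅ yoneda :=
  NatIso.ofComponents (fun X => NatIso.ofComponents (fun Y =>
    (Equiv.ulift.trans (Functor.FullyFaithful.ofFullyFaithful K).homEquiv.symm).toIso)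
    (fun f => by
      ext x
      apply K.map_injective
      refine (K.map_preimage _).trans (Eq.symm ((K.map_comp _ _).trans ?_))
      exact congrArg (K.map f.unop ≫ ·) (K.map_preimage _)))
    (fun f => by
      ext Y x
      apply K.map_injective
      refine (K.map_preimage _).trans (Eq.symm ((K.map_comp _ _).trans ?_))
      exact congrArg (· ≫ K.map f) (K.map_preimage _))

namespace Functor.IsCompactValued

variable (hK : K.IsCompactValued) [K.Full] [K.Faithful]
  (hpres : ∀ d : D, ∃ (J : Type v) (_ : SmallCategory J) (_ : IsFiltered J) (F : J ⥤ C)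
    (c : Cocone (F ⋙ K)) (_ : IsColimit c), c.pt = d)
include hK

lemma isIndObject_of_isColimit {J : Type v} [SmallCategory J] [IsFiltered J] {F : J ⥤ C}
    {c : Cocone (F ⋙ K)} (hc : IsColimit c) :
    IsIndObject ((Presheaf.restrictedULiftYoneda.{v} K).obj c.pt) :=
  .mk (IndObjectPresentation.ofCocone _ ((IsColimit.precomposeInvEquiv
    (Functor.isoWhiskerLeft F (compRestrictedULiftYonedaIso K)) _).symm
      (hK.isColimitMapCocone hc)))

include hpres

/-- If `K : C ⥤ D` is fully faithful with compact values, small filtered colimits of values of `K`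
exist and every object of `D` is such a colimit, then `D` is the ind-completion of `C`. -/
lemma exists_equivalence_ind (hcolim : ∀ (J : Type v) [SmallCategory J] [IsFiltered J] (F : J ⥤ C),
      HasColimit (F ⋙ K)) :
    ∃ e : D ≌ Ind C, Nonempty (K ⋙ e.functor ≅ Ind.yoneda) := by
  have := hK.isDense hpres
  let R := Presheaf.restrictedULiftYoneda.{v} K
  have hR : ∀ d, IsIndObject (R.obj d) := fun d => by
    obtain ⟨J, _, _, F, c, hc, rfl⟩ := hpres d
    exact hK.isIndObject_of_isColimit hc
  let R' : D ⥤ ObjectProperty.FullSubcategory (IsIndObject (C := C)) := ObjectProperty.lift _ R hR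
  -- An ind-object is a filtered colimit of representables; the colimit in `D` of the corresponding
  -- values of `K` is sent to it.
  have : R'.EssSurj := ⟨fun X => by
    let P := X.property.presentation
    have := hcolim P.I P.F
    let c := colimit.cocone (P.F ⋙ K)
    have h := (IsColimit.precomposeInvEquiv
      (Functor.isoWhiskerLeft P.F (compRestrictedULiftYonedaIso K)) _).symm
        (hK.isColimitMapCocone (colimit.isColimit (P.F ⋙ K)))
    exact ⟨c.pt, ⟨ObjectProperty.isoMk _ (h.coconePointUniqueUpToIso P.isColimit)⟩⟩⟩
  -- Density of `K` is what makes the restricted Yoneda functor fully faithful.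
  have : R'.Full := inferInstanceAs (ObjectProperty.lift _ R hR).Full
  have : R'.Faithful := inferInstanceAs (ObjectProperty.lift _ R hR).Faithful
  have : R'.IsEquivalence := { }
  let i : K ⋙ R' ≅ ObjectProperty.lift _ yoneda isIndObject_yoneda :=
    NatIso.ofComponents (fun X =>
      ObjectProperty.isoMk _ ((compRestrictedULiftYonedaIso K).app X)) fun f =>
        ObjectProperty.hom_ext _ ((compRestrictedULiftYonedaIso K).hom.naturality f)
  exact ⟨R'.asEquivalence.trans (Ind.equivalence C).symm,
    ⟨Functor.isoWhiskerRight i (Ind.equivalence C).inverse⟩⟩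

end Functor.IsCompactValued

end IndCompletion

end CategoryTheory

/-! ### Morphisms, subalgebras and products of modal algebras. -/

namespace ModalAlg

section Hom

variable {A B C D : ModalAlg.{u}}

lemma fn_comp (f : A ⟶ B) (g : B ⟶ C) (a : A) : fn (f ≫ g) a = fn g (fn f a) := rfl

lemma hom_ext {f g : A ⟶ B} (h : ∀ a, fn f a = fn g a) : f = g :=
  Hom.ext (DFunLike.ext _ _ h)

lemma fn_sup (f : A ⟶ B) (a b : A) : fn f (a ⊔ b) = fn f a ⊔ fn f b := map_sup (Hom.toBool f) a b

lemma fn_inf (f : A ⟶ B) (a b : A) : fn f (a ⊓ b) = fn f a ⊓ fn f b := map_inf (Hom.toBool f) a b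

lemma fn_bot (f : A ⟶ B) : fn f ⊥ = ⊥ := map_bot (Hom.toBool f)

lemma fn_top (f : A ⟶ B) : fn f ⊤ = ⊤ := map_top (Hom.toBool f)

lemma fn_compl (f : A ⟶ B) (a : A) : fn f aᶜ = (fn f a)ᶜ := map_compl' (Hom.toBool f) a

lemma fn_sdiff (f : A ⟶ B) (a b : A) : fn f (a \ b) = fn f a \ fn f b :=
  map_sdiff' (Hom.toBool f) a b

lemma fn_dia (f : A ⟶ B) (a : A) : fn f (A.dia a) = B.dia (fn f a) := Hom.map_dia f a

lemma fn_mono (f : A ⟶ B) : Monotone (fn f) := OrderHomClass.mono (Hom.toBool f)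

/-- A function commuting with the operations of modal algebras is a morphism. -/
def homMk (f : A → B) (hsup : ∀ a b, f (a ⊔ b) = f a ⊔ f b) (hinf : ∀ a b, f (a ⊓ b) = f a ⊓ f b)
    (hbot : f ⊥ = ⊥) (htop : f ⊤ = ⊤) (hdia : ∀ a, f (A.dia a) = B.dia (f a)) : A ⟶ B :=
  ModalAlg.Hom.mk ⟨⟨⟨f, hsup⟩, hinf⟩, htop, hbot⟩ hdia

/-- If `q : D ⟶ B` hits every value of `p : A ⟶ B` and its kernel is contained in that of
`h : D ⟶ C`, then `h` induces a morphism `A ⟶ C`. -/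
lemma exists_hom_of_fibers (p : A ⟶ B) (q : D ⟶ B) (h : D ⟶ C)
    (hpq : ∀ a, ∃ d, fn q d = fn p a) (hqh : ∀ d d', fn q d = fn q d' → fn h d = fn h d') :
    ∃ g : A ⟶ C, ∀ a d, fn q d = fn p a → fn g a = fn h d := by
  -- The section `s` need not respect the operations, but two elements with the same value under `q`
  -- have the same value under `h`.
  choose s hs using hpq
  refine ⟨homMk (fun a => fn h (s a)) (fun a b => ?_) (fun a b => ?_) ?_ ?_ fun a => ?_, ?_⟩
  · rw [← fn_sup]; exact hqh _ _ (by rw [fn_sup, hs, hs, hs, fn_sup])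
  · rw [← fn_inf]; exact hqh _ _ (by rw [fn_inf, hs, hs, hs, fn_inf])
  · rw [← fn_bot h]; exact hqh _ _ (by rw [hs, fn_bot, fn_bot])
  · rw [← fn_top h]; exact hqh _ _ (by rw [hs, fn_top, fn_top])
  · rw [← fn_dia]; exact hqh _ _ (by rw [fn_dia, hs, hs, fn_dia])
  · intro a d hd
    exact hqh _ _ ((hs a).trans hd.symm)

lemma eq_of_comp_eq_of_surjective {f : A ⟶ B} (hf : Function.Surjective (fn f)) {g h : B ⟶ C}
    (hgh : f ≫ g = f ≫ h) : g = h := by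
  refine hom_ext fun b => ?_
  obtain ⟨a, rfl⟩ := hf b
  rw [← fn_comp, hgh, fn_comp]

end Hom

/-- The forgetful functor to sets. -/
def forgetToType : ModalAlg.{u} ⥤ Type u where
  obj A := A
  map f := ↾(fn f)

/-- A Boolean subalgebra closed under `dia`, as a modal algebra. -/
def sub (A : ModalAlg.{u}) (L : BooleanSubalgebra A) (hL : ∀ a ∈ L, A.dia a ∈ L) :
    ModalAlg.{u} where
  carrier := L
  dia a := ⟨A.dia a, hL _ a.2⟩
  dia_sup a b := Subtype.ext (A.dia_sup a b)
  dia_bot := Subtype.ext A.dia_bot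

/-- The inclusion of a subalgebra. -/
def subHom (A : ModalAlg.{u}) (L : BooleanSubalgebra A) (hL : ∀ a ∈ L, A.dia a ∈ L) :
    A.sub L hL ⟶ A :=
  ModalAlg.Hom.mk L.subtype fun _ => rfl

/-- The product of a family of modal algebras. -/
def pi {ι : Type u} (A : ι → ModalAlg.{u}) : ModalAlg.{u} where
  carrier := ∀ i, A i
  dia a i := (A i).dia (a i)
  dia_sup a b := funext fun i => (A i).dia_sup (a i) (b i)
  dia_bot := funext fun i => (A i).dia_bot

/-- The product of two modal algebras. -/
def prod (A B : ModalAlg.{u}) : ModalAlg.{u} where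
  carrier := A × B
  dia a := (A.dia a.1, B.dia a.2)
  dia_sup a b := Prod.ext (A.dia_sup a.1 b.1) (B.dia_sup a.2 b.2)
  dia_bot := Prod.ext A.dia_bot B.dia_bot

/-- The one-element modal algebra. -/
def trivial : ModalAlg.{u} where
  carrier := PUnit
  dia a := a
  dia_sup _ _ := rfl
  dia_bot := rfl

/-- The image of a morphism. -/
def range {A B : ModalAlg.{u}} (f : A ⟶ B) : BooleanSubalgebra B where
  carrier := Set.range (fn f)
  supClosed' := by
    rintro _ ⟨a, rfl⟩ _ ⟨b, rfl⟩
    exact ⟨a ⊔ b, fn_sup f a b⟩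
  infClosed' := by
    rintro _ ⟨a, rfl⟩ _ ⟨b, rfl⟩
    exact ⟨a ⊓ b, fn_inf f a b⟩
  compl_mem' := by
    rintro _ ⟨a, rfl⟩
    exact ⟨aᶜ, fn_compl f a⟩
  bot_mem' := ⟨⊥, fn_bot f⟩

/-- Two morphisms to finite modal algebras factor through a common surjection onto a finite modal
algebra. -/
lemma exists_surjective_factorization {A B C : ModalAlg.{u}} [Finite B] [Finite C]
    (f : A ⟶ B) (g : A ⟶ C) :
    ∃ (D : ModalAlg.{u}) (_ : Finite D) (e : A ⟶ D) (p : D ⟶ B) (q : D ⟶ C),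
      Function.Surjective (fn e) ∧ e ≫ p = f ∧ e ≫ q = g := by
  -- The common factor is the image of `A` in the product.
  let h : A ⟶ B.prod C := homMk (fun a => (fn f a, fn g a))
    (fun a b => Prod.ext (fn_sup f a b) (fn_sup g a b))
    (fun a b => Prod.ext (fn_inf f a b) (fn_inf g a b))
    (Prod.ext (fn_bot f) (fn_bot g)) (Prod.ext (fn_top f) (fn_top g))
    (fun a => Prod.ext (fn_dia f a) (fn_dia g a))
  have hdia : ∀ a ∈ range h, (B.prod C).dia a ∈ range h := by
    rintro _ ⟨a, rfl⟩
    exact ⟨A.dia a, fn_dia h a⟩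
  let fst : B.prod C ⟶ B := homMk (fun a => a.1) (fun _ _ => rfl) (fun _ _ => rfl) rfl rfl
    (fun _ => rfl)
  let snd : B.prod C ⟶ C := homMk (fun a => a.2) (fun _ _ => rfl) (fun _ _ => rfl) rfl rfl
    (fun _ => rfl)
  let i := subHom _ (range h) hdia
  let e : A ⟶ (B.prod C).sub (range h) hdia := homMk (fun a => ⟨fn h a, a, rfl⟩)
    (fun a b => Subtype.ext (fn_sup h a b)) (fun a b => Subtype.ext (fn_inf h a b))
    (Subtype.ext (fn_bot h)) (Subtype.ext (fn_top h)) (fun a => Subtype.ext (fn_dia h a))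
  refine ⟨_, inferInstanceAs (Finite { x : B × C // x ∈ range h }), e, i ≫ fst, i ≫ snd, ?_,
    rfl, rfl⟩
  rintro ⟨_, a, rfl⟩
  exact ⟨a, rfl⟩

end ModalAlg

/-! ### Limits of complete algebras as algebras of compatible families. -/

namespace CAMA

variable {J : Type u} [SmallCategory J]

/-- The family `s` of elements of the algebras of a diagram is compatible. -/
def IsCompatible (G : J ⥤ CAMA.{u}) (s : ∀ j, (G.obj j).obj) : Prop :=
  ∀ ⦃i j : J⦄ (t : i ⟶ j), fn (G.map t).hom (s i) = s j

/-- A cone whose elements are precisely the compatible families of a diagram. -/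
def IsConcreteLimit {G : J ⥤ CAMA.{u}} (c : Cone G) : Prop :=
  (∀ x y : c.pt.obj, (∀ j, fn (c.π.app j).hom x = fn (c.π.app j).hom y) → x = y) ∧
    ∀ s, IsCompatible G s → ∃ x : c.pt.obj, ∀ j, fn (c.π.app j).hom x = s j

lemma w_apply {G : J ⥤ CAMA.{u}} (c : Cone G) {i j : J} (t : i ⟶ j) (x : c.pt.obj) :
    fn (G.map t).hom (fn (c.π.app i).hom x) = fn (c.π.app j).hom x := by
  rw [← fn_comp]
  exact congrArg (fun f => fn (CAMA.Hom.hom f) x) (c.w t)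

namespace IsConcreteLimit

variable {G : J ⥤ CAMA.{u}} {c : Cone G} (hc : IsConcreteLimit c)
include hc

lemma exists_hom {A : ModalAlg.{u}} (g : ∀ j, A ⟶ (G.obj j).obj)
    (hg : ∀ ⦃i j : J⦄ (t : i ⟶ j), g i ≫ (G.map t).hom = g j) :
    ∃ f : A ⟶ c.pt.obj, ∀ j, f ≫ (c.π.app j).hom = g j := by
  have hs : ∀ x, IsCompatible G fun j => fn (g j) x := fun x i j t =>
    (fn_comp _ _ _).symm.trans (congrArg (fun f => fn f x) (hg t))
  choose f hf using fun x => hc.2 _ (hs x)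
  refine ⟨homMk f (fun a b => hc.1 _ _ fun j => ?_) (fun a b => hc.1 _ _ fun j => ?_)
    (hc.1 _ _ fun j => ?_) (hc.1 _ _ fun j => ?_) (fun a => hc.1 _ _ fun j => ?_),
    fun j => hom_ext fun x => hf x j⟩
  · rw [fn_sup, hf, hf, hf, fn_sup]
  · rw [fn_inf, hf, hf, hf, fn_inf]
  · rw [fn_bot, hf, fn_bot]
  · rw [fn_top, hf, fn_top]
  · exact (hf _ j).trans ((fn_dia (g j) a).trans
      ((fn_dia (c.π.app j).hom (f a)).trans (congrArg _ (hf a j))).symm)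

lemma hom_ext {A : ModalAlg.{u}} {f g : A ⟶ c.pt.obj}
    (h : ∀ j, f ≫ (c.π.app j).hom = g ≫ (c.π.app j).hom) : f = g :=
  ModalAlg.hom_ext fun x => hc.1 _ _ fun j => congrArg (fun k => fn k x) (h j)

/-- A concrete limit is a limit of modal algebras. -/
noncomputable def isLimitMapCone : IsLimit (toMA.mapCone c) where
  lift s := (hc.exists_hom (fun j => s.π.app j) fun _ _ t => s.w t).choose
  fac s := (hc.exists_hom (fun j => s.π.app j) fun _ _ t => s.w t).choose_spec
  uniq s _ hm := hc.hom_ext fun j => (hm j).trans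
    ((hc.exists_hom (fun j => s.π.app j) fun _ _ t => s.w t).choose_spec j).symm

lemma le_of_forall {x y : c.pt.obj}
    (h : ∀ j, fn (c.π.app j).hom x ≤ fn (c.π.app j).hom y) : x ≤ y := by
  rw [← inf_eq_left]
  exact hc.1 _ _ fun j => by rw [fn_inf]; exact inf_eq_left.2 (h j)

lemma isLUB_of_forall {S : Set c.pt.obj} {a : c.pt.obj}
    (h : ∀ j, IsLUB (fn (c.π.app j).hom '' S) (fn (c.π.app j).hom a)) : IsLUB S a := by
  refine ⟨fun x hx => hc.le_of_forall fun j => (h j).1 ⟨x, hx, rfl⟩, fun b hb => hc.le_of_forall fun j =>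
    (h j).2 ?_⟩
  rintro _ ⟨x, hx, rfl⟩
  exact fn_mono _ (hb hx)

lemma isGLB_of_forall {S : Set c.pt.obj} {a : c.pt.obj}
    (h : ∀ j, IsGLB (fn (c.π.app j).hom '' S) (fn (c.π.app j).hom a)) : IsGLB S a := by
  refine ⟨fun x hx => hc.le_of_forall fun j => (h j).1 ⟨x, hx, rfl⟩, fun b hb => hc.le_of_forall fun j =>
    (h j).2 ?_⟩
  rintro _ ⟨x, hx, rfl⟩
  exact fn_mono _ (hb hx)

lemma isComplete {A : ModalAlg.{u}} {f : A ⟶ c.pt.obj}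
    (hf : ∀ j, IsComplete (f ≫ (c.π.app j).hom)) : IsComplete f := fun S a =>
  ⟨fun h => hc.isLUB_of_forall fun j => by
    rw [← Set.image_comp]; exact (hf j S a).1 h,
  fun h => hc.isGLB_of_forall fun j => by
    rw [← Set.image_comp]; exact (hf j S a).2 h⟩

/-- A concrete limit is a limit. -/
noncomputable def isLimit : IsLimit c where
  lift s := ⟨hc.isLimitMapCone.lift (toMA.mapCone s), hc.isComplete fun j => by
    have := hc.isLimitMapCone.fac (toMA.mapCone s) j
    exact this ▸ (s.π.app j).complete⟩
  fac s j := CAMA.Hom.ext (hc.isLimitMapCone.fac (toMA.mapCone s) j)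
  uniq s m hm := CAMA.Hom.ext (hc.isLimitMapCone.uniq (toMA.mapCone s) m.hom
    fun j => congrArg CAMA.Hom.hom (hm j))

end IsConcreteLimit

section Construction

variable (G : J ⥤ CAMA.{u})

/-- The Boolean algebra of compatible families. -/
def sections : BooleanSubalgebra (ModalAlg.pi fun j => (G.obj j).obj) where
  carrier := { s | IsCompatible G s }
  supClosed' _ hs _ ht _ _ f := (fn_sup _ _ _).trans (congrArg₂ _ (hs f) (ht f))
  infClosed' _ hs _ ht _ _ f := (fn_inf _ _ _).trans (congrArg₂ _ (hs f) (ht f))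
  compl_mem' hs _ _ f := (fn_compl _ _).trans (congrArg _ (hs f))
  bot_mem' _ _ _ := fn_bot _

/-- The modal algebra of compatible families. -/
def limitAlg : ModalAlg.{u} :=
  (ModalAlg.pi fun j => (G.obj j).obj).sub (sections G) fun _ hs _ _ f =>
    (fn_dia _ _).trans (congrArg _ (hs f))

/-- The projections from the algebra of compatible families. -/
def limitProj (j : J) : limitAlg G ⟶ (G.obj j).obj :=
  homMk (fun s => s.1 j) (fun _ _ => rfl) (fun _ _ => rfl) rfl rfl (fun _ => rfl)

/-- Pointwise joins form a compatible family because the transition maps preserve joins. -/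
lemma exists_isLUB_limitAlg (S : Set (limitAlg G)) :
    ∃ a, IsLUB S a ∧ ∀ j, IsLUB (fn (limitProj G j) '' S) (fn (limitProj G j) a) := by
  choose a ha using fun j => (G.obj j).property.1 (fn (limitProj G j) '' S)
  have hcomp : IsCompatible G a := fun i j t => by
    refine IsLUB.unique (((G.map t).complete _ _).1 (ha i)) ?_
    have : fn (G.map t).hom '' (fn (limitProj G i) '' S) = fn (limitProj G j) '' S := by
      rw [← Set.image_comp]
      exact Set.image_congr fun s _ => s.2 t
    exact this ▸ ha j
  refine ⟨⟨a, hcomp⟩, ⟨fun x hx j => (ha j).1 ⟨x, hx, rfl⟩, fun b hb j => (ha j).2 ?_⟩, ha⟩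
  rintro _ ⟨x, hx, rfl⟩
  exact hb hx j

lemma isComplete_limitProj (j : J) : IsComplete (limitProj G j) := by
  have hL : ∀ (S : Set (limitAlg G)) a, IsLUB S a →
      IsLUB (fn (limitProj G j) '' S) (fn (limitProj G j) a) := fun S a h => by
    obtain ⟨b, hb, hb'⟩ := exists_isLUB_limitAlg G S
    exact h.unique hb ▸ hb' j
  refine fun S a => ⟨hL S a, fun h => ?_⟩
  -- Preservation of meets follows from that of joins by complementation.
  have hc : IsLUB (compl '' S) aᶜ := by
    refine ⟨?_, fun b hb => ?_⟩
    · rintro _ ⟨x, hx, rfl⟩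
      exact compl_le_compl (h.1 hx)
    · exact compl_le_of_compl_le (h.2 fun x hx => compl_le_of_compl_le (hb ⟨x, hx, rfl⟩))
  have h2 := hL _ _ hc
  refine ⟨?_, fun b hb => ?_⟩
  · rintro _ ⟨x, hx, rfl⟩
    exact fn_mono _ (h.1 hx)
  · rw [fn_compl] at h2
    refine compl_le_compl_iff_le.1 (h2.2 ?_)
    rintro _ ⟨_, ⟨x, hx, rfl⟩, rfl⟩
    rw [fn_compl]
    exact compl_le_compl (hb ⟨x, hx, rfl⟩)

lemma exists_isGLB_limitAlg (S : Set (limitAlg G)) : ∃ a, IsGLB S a := by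
  obtain ⟨a, ha, -⟩ := exists_isLUB_limitAlg G (lowerBounds S)
  exact ⟨a, isLUB_lowerBounds.1 ha⟩

lemma isAtomic_limitAlg : IsAtomic (limitAlg G) := by
  refine ⟨fun a => or_iff_not_imp_left.2 fun ha => ?_⟩
  obtain ⟨j, hj⟩ : ∃ j, fn (limitProj G j) a ≠ ⊥ := by
    by_contra! h
    exact ha (le_bot_iff.1 fun j => (h j).le)
  have := (G.obj j).property.2.1
  obtain ⟨x, hx, hxa⟩ := (IsAtomic.eq_bot_or_exists_atom_le (fn (limitProj G j) a)).resolve_left hj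
  -- `b` is the least family whose component at `j` lies above the atom `x`, as the projection
  -- preserves meets. It is an atom: if `c < b`, then `x` is below or disjoint from the component of
  -- `c`. The first case would give `b ≤ c`; the second gives `b ≤ b \ c`, so `c = ⊥`.
  obtain ⟨b, hb⟩ := exists_isGLB_limitAlg G { c | x ≤ fn (limitProj G j) c }
  have hxb : x ≤ fn (limitProj G j) b := ((isComplete_limitProj G j _ _).2 hb).2 (by
    rintro _ ⟨c, hc, rfl⟩
    exact hc)
  refine ⟨b, ⟨?_, fun c hc => ?_⟩, hb.1 hxa⟩
  · rintro rfl
    rw [fn_bot] at hxb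
    exact hx.1 (le_bot_iff.1 hxb)
  · by_cases h : x ≤ fn (limitProj G j) c
    · exact absurd (hb.1 h) hc.not_ge
    · have hd : Disjoint x (fn (limitProj G j) c) := hx.not_le_iff_disjoint.1 h
      have hbc : b ≤ b \ c := hb.1 (by
        change x ≤ fn (limitProj G j) (b \ c)
        rw [fn_sdiff]
        exact le_sdiff.2 ⟨hxb, hd⟩)
      exact disjoint_self.1 ((le_sdiff.1 (hc.le.trans hbc)).2)

lemma isCAMA_limitAlg : IsCAMA (limitAlg G) := by
  refine ⟨fun S => (exists_isLUB_limitAlg G S).imp fun _ h => h.1, isAtomic_limitAlg G,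
    fun S a h => ?_⟩
  have key : ∀ j, IsLUB (fn (limitProj G j) '' ((limitAlg G).dia '' S))
      (fn (limitProj G j) ((limitAlg G).dia a)) := fun j => by
    have := (G.obj j).property.2.2 _ _ ((isComplete_limitProj G j S a).1 h)
    rw [← Set.image_comp] at this ⊢
    rw [fn_dia]
    exact this
  refine ⟨?_, fun b hb j => (key j).2 ?_⟩
  · rintro _ ⟨x, hx, rfl⟩ j
    exact (key j).1 ⟨_, ⟨x, hx, rfl⟩, rfl⟩
  · rintro _ ⟨x, hx, rfl⟩
    exact hb hx j

/-- The limit cone of compatible families. -/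
def limitCone : Cone G where
  pt := ⟨limitAlg G, isCAMA_limitAlg G⟩
  π :=
    { app j := ⟨limitProj G j, isComplete_limitProj G j⟩
      naturality _ _ t := CAMA.Hom.ext (hom_ext fun s => (s.2 t).symm) }

lemma isConcreteLimit_limitCone : IsConcreteLimit (limitCone G) :=
  ⟨fun _ _ h => Subtype.ext (funext h), fun s hs => ⟨⟨s, hs⟩, fun _ => rfl⟩⟩

end Construction

lemma isConcreteLimit_of_isLimit {G : J ⥤ CAMA.{u}} {c : Cone G} (hc : IsLimit c) :
    IsConcreteLimit c := by
  have hL := isConcreteLimit_limitCone G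
  let e := hc.conePointUniqueUpToIso hL.isLimit
  have he : ∀ j x, fn (c.π.app j).hom x = fn (limitProj G j) (fn e.hom.hom x) := fun j x =>
    congrArg (fun f => fn (CAMA.Hom.hom f) x)
      (hc.conePointUniqueUpToIso_hom_comp hL.isLimit j).symm
  have he' : ∀ j x, fn (c.π.app j).hom (fn e.inv.hom x) = fn (limitProj G j) x := fun j x =>
    congrArg (fun f => fn (CAMA.Hom.hom f) x)
      (hc.conePointUniqueUpToIso_inv_comp hL.isLimit j)
  refine ⟨fun x y h => ?_, fun s hs => ?_⟩
  · have hxy : fn e.hom.hom x = fn e.hom.hom y := hL.1 _ _ fun j => by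
      exact (he j x).symm.trans ((h j).trans (he j y))
    have hid : ∀ z, fn e.inv.hom (fn e.hom.hom z) = z := fun z =>
      congrArg (fun f => fn (CAMA.Hom.hom f) z) e.hom_inv_id
    rw [← hid x, hxy, hid]
  · obtain ⟨x, hx⟩ := hL.2 s hs
    exact ⟨fn e.inv.hom x, fun j => (he' j x).trans (hx j)⟩

end CAMA

/-! ### Cocompactness of finite algebras. -/

namespace CAMA

section Cofiltered

variable {J : Type u} [SmallCategory J] [IsCofiltered J] {F : J ⥤ FinModalAlg.{u}}
  {c : Cone (F ⋙ FinModalAlg.toCAMA)}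

/-- The range of a projection from a cofiltered limit of finite algebras is the range of a
transition map. -/
lemma IsConcreteLimit.exists_range_subset (hc : IsConcreteLimit c) (j : J) :
    ∃ (k : J) (t : k ⟶ j), ∀ x : (F.obj k).obj, ∃ y : c.pt.obj,
      fn (c.π.app j).hom y = fn (F.map t).hom x := by
  let U : J ⥤ Type u := F ⋙ ObjectProperty.ι _ ⋙ forgetToType
  have : ∀ j, Finite (U.obj j) := fun j => (F.obj j).property
  have : ∀ j, Nonempty (U.obj j) := fun j => ⟨(⊥ : (F.obj j).obj)⟩
  -- Finiteness makes the images in each algebra stabilize. The eventual ranges then have surjective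
  -- transition maps, so each of their elements extends to a compatible family.
  have hU : U.IsMittagLeffler :=
    U.isMittagLeffler_of_exists_finite_range fun j => ⟨j, 𝟙 j, Set.toFinite _⟩
  have : ∀ j, Nonempty (U.toEventualRanges.obj j) := U.toEventualRanges_nonempty hU
  obtain ⟨k, t, ht⟩ := U.isMittagLeffler_iff_eventualRange.1 hU j
  refine ⟨k, t, fun x => ?_⟩
  have hx : U.map t x ∈ U.eventualRange j := ht ▸ ⟨x, rfl⟩
  obtain ⟨s, hs⟩ := U.toEventualRanges.eval_section_surjective_of_surjective
    (U.surjective_toEventualRanges hU) j ⟨_, hx⟩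
  obtain ⟨y, hy⟩ := hc.2 (U.toEventualRangesSectionsEquiv s).1
    fun i j t => (U.toEventualRangesSectionsEquiv s).2 t
  exact ⟨y, (hy j).trans (congrArg Subtype.val hs)⟩

/-- A complete morphism from a cofiltered limit of finite algebras to a finite algebra identifies
all elements identified by some projection. -/
lemma IsConcreteLimit.exists_ker_le (hc : IsConcreteLimit c) {C : CAMA.{u}} [Finite C.obj]
    (h : c.pt ⟶ C) :
    ∃ j, ∀ x y : c.pt.obj, fn (c.π.app j).hom x = fn (c.π.app j).hom y →
      fn h.hom x = fn h.hom y := by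
  -- `z j` is the largest element killed by the projection to `j`. These elements decrease along the
  -- diagram and have meet `⊥`, which `h` preserves.
  choose z hz using fun j => c.pt.property.1 { x | fn (c.π.app j).hom x = ⊥ }
  have hz0 : ∀ j, fn (c.π.app j).hom (z j) = ⊥ := fun j => by
    refine (((c.π.app j).complete _ _).1 (hz j)).unique ⟨?_, fun _ _ => bot_le⟩
    rintro _ ⟨x, hx, rfl⟩
    exact hx.le
  have hmono : ∀ {i j : J} (_ : i ⟶ j), z i ≤ z j := fun {i j} t => (hz j).1 (by
    change fn (c.π.app j).hom (z i) = ⊥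
    rw [← w_apply c t, hz0, fn_bot])
  have hinf : IsGLB (Set.range z) ⊥ := by
    refine ⟨fun _ _ => bot_le, fun b hb => (hc.1 b ⊥ fun j => ?_).le⟩
    rw [fn_bot, ← le_bot_iff, ← hz0 j]
    exact fn_mono _ (hb ⟨j, rfl⟩)
  have hinf' := (h.complete _ _).2 hinf
  -- Finitely many values occur, and by cofilteredness a minimal one lies below all the others, so
  -- it is their meet `⊥`.
  obtain ⟨_, ⟨j, rfl⟩, hj⟩ := (Set.toFinite (Set.range fun j => fn h.hom (z j))).exists_minimal
    ⟨_, (IsCofiltered.nonempty (C := J)).some, rfl⟩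
  have hbot : fn h.hom (z j) = ⊥ := by
    rw [← le_bot_iff, ← fn_bot h.hom]
    refine hinf'.2 ?_
    rintro _ ⟨_, ⟨k, rfl⟩, rfl⟩
    refine (hj ⟨IsCofiltered.min j k, rfl⟩ ?_).trans ?_
    · exact fn_mono _ (hmono (IsCofiltered.minToLeft j k))
    · exact fn_mono _ (hmono (IsCofiltered.minToRight j k))
  have key : ∀ x y : c.pt.obj, fn (c.π.app j).hom x = fn (c.π.app j).hom y →
      fn h.hom x ≤ fn h.hom y := fun x y hxy => by
    rw [← sdiff_eq_bot_iff, ← fn_sdiff, ← le_bot_iff, ← hbot]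
    refine fn_mono _ ((hz j).1 ?_)
    change fn (c.π.app j).hom (x \ y) = ⊥
    rw [fn_sdiff, hxy, sdiff_self]
  exact ⟨j, fun x y hxy => (key x y hxy).antisymm (key y x hxy.symm)⟩

/-- Finite algebras are cocompact: a morphism from a cofiltered limit of finite algebras to a finite
algebra factors through a projection. -/
lemma IsConcreteLimit.exists_factorization (hc : IsConcreteLimit c) {C : FinModalAlg.{u}}
    (h : c.pt ⟶ FinModalAlg.toCAMA.obj C) :
    ∃ (k : J) (g : F.obj k ⟶ C), c.π.app k ≫ FinModalAlg.toCAMA.map g = h := by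
  have : Finite (FinModalAlg.toCAMA.obj C).obj := C.property
  obtain ⟨j, hj⟩ := hc.exists_ker_le h
  obtain ⟨k, t, ht⟩ := hc.exists_range_subset j
  obtain ⟨g, hg⟩ := exists_hom_of_fibers (F.map t).hom (c.π.app j).hom h.hom ht hj
  exact ⟨k, ⟨g⟩, CAMA.Hom.ext (ModalAlg.hom_ext fun x => hg _ x (w_apply c t x).symm)⟩

/-- The two maps agree on the range of the projection, which contains the range of some transition
map. -/
lemma IsConcreteLimit.exists_comp_eq (hc : IsConcreteLimit c) {C : FinModalAlg.{u}} {j : J}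
    {f g : F.obj j ⟶ C}
    (h : c.π.app j ≫ FinModalAlg.toCAMA.map f = c.π.app j ≫ FinModalAlg.toCAMA.map g) :
    ∃ (k : J) (t : k ⟶ j), F.map t ≫ f = F.map t ≫ g := by
  obtain ⟨k, t, ht⟩ := hc.exists_range_subset j
  refine ⟨k, t, ObjectProperty.hom_ext _ (ModalAlg.hom_ext fun x => ?_)⟩
  obtain ⟨y, hy⟩ := ht x
  have := congrArg (fun k => fn (CAMA.Hom.hom k) y) h
  change fn f.hom (fn (F.map t).hom x) = fn g.hom (fn (F.map t).hom x)
  rw [← hy]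
  exact this

end Cofiltered

end CAMA

/-! ### Transfer to profinite algebras. -/

namespace ProMA

variable {J : Type u} [SmallCategory J] [IsCofiltered J] {F : J ⥤ FinModalAlg.{u}}

/-- The limit in `ProMA` of a cofiltered diagram of finite modal algebras. -/
def limitCone (F : J ⥤ FinModalAlg.{u}) : Cone (F ⋙ FinModalAlg.toPro) where
  pt := ⟨(CAMA.limitCone (F ⋙ FinModalAlg.toCAMA)).pt, J, inferInstance, inferInstance, F,
    CAMA.limitCone _, ⟨(CAMA.isConcreteLimit_limitCone _).isLimit⟩, rfl⟩
  π :=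
    { app j := ⟨(CAMA.limitCone (F ⋙ FinModalAlg.toCAMA)).π.app j⟩
      naturality _ _ t :=
        ObjectProperty.hom_ext _ ((CAMA.limitCone (F ⋙ FinModalAlg.toCAMA)).π.naturality t) }

/-- The underlying cone in `CAMA` of a cone over a diagram of finite algebras. -/
abbrev toCAMACone (c : Cone (F ⋙ FinModalAlg.toPro)) : Cone (F ⋙ FinModalAlg.toCAMA) :=
  (IsProfiniteMA.ι).mapCone c

/-- A cone of profinite algebras is a limit as soon as it is one in `CAMA`. -/
noncomputable def isLimitOfToCAMACone {c : Cone (F ⋙ FinModalAlg.toPro)} (hc : IsLimit (toCAMACone c)) :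
    IsLimit c :=
  isLimitOfReflects IsProfiniteMA.ι hc

lemma isConcreteLimit_of_isLimit {c : Cone (F ⋙ FinModalAlg.toPro)} (hc : IsLimit c) :
    CAMA.IsConcreteLimit (toCAMACone c) := by
  have hL : IsLimit (toCAMACone (limitCone F)) := (CAMA.isConcreteLimit_limitCone _).isLimit
  have e := hc.uniqueUpToIso (isLimitOfToCAMACone hL)
  exact CAMA.isConcreteLimit_of_isLimit
    (hL.ofIsoLimit ((Cone.functoriality _ IsProfiniteMA.ι).mapIso e.symm))

lemma exists_factorization {c : Cone (F ⋙ FinModalAlg.toPro)} (hc : IsLimit c)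
    {C : FinModalAlg.{u}} (h : c.pt ⟶ FinModalAlg.toPro.obj C) :
    ∃ (k : J) (g : F.obj k ⟶ C), c.π.app k ≫ FinModalAlg.toPro.map g = h := by
  obtain ⟨k, g, hg⟩ := (isConcreteLimit_of_isLimit hc).exists_factorization h.hom
  exact ⟨k, g, ObjectProperty.hom_ext _ hg⟩

lemma exists_comp_eq {c : Cone (F ⋙ FinModalAlg.toPro)} (hc : IsLimit c)
    {C : FinModalAlg.{u}} {j : J} {f g : F.obj j ⟶ C}
    (h : c.π.app j ≫ FinModalAlg.toPro.map f = c.π.app j ≫ FinModalAlg.toPro.map g) :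
    ∃ (k : J) (t : k ⟶ j), F.map t ≫ f = F.map t ≫ g :=
  (isConcreteLimit_of_isLimit hc).exists_comp_eq (congrArg (fun k => k.hom) h)

lemma exists_common_factorization {c : Cone (F ⋙ FinModalAlg.toPro)} (hc : IsLimit c)
    {C : FinModalAlg.{u}} (h₁ h₂ : c.pt ⟶ FinModalAlg.toPro.obj C) :
    ∃ (k : J) (g₁ g₂ : F.obj k ⟶ C), c.π.app k ≫ FinModalAlg.toPro.map g₁ = h₁ ∧
      c.π.app k ≫ FinModalAlg.toPro.map g₂ = h₂ := by
  obtain ⟨k₁, g₁, rfl⟩ := exists_factorization hc h₁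
  obtain ⟨k₂, g₂, rfl⟩ := exists_factorization hc h₂
  refine ⟨IsCofiltered.min k₁ k₂, F.map (IsCofiltered.minToLeft k₁ k₂) ≫ g₁,
    F.map (IsCofiltered.minToRight k₁ k₂) ≫ g₂, ?_, ?_⟩
  · rw [Functor.map_comp, ← Category.assoc]
    exact congrArg (· ≫ _) (c.w (IsCofiltered.minToLeft k₁ k₂))
  · rw [Functor.map_comp, ← Category.assoc]
    exact congrArg (· ≫ _) (c.w (IsCofiltered.minToRight k₁ k₂))

/-- Every profinite modal algebra is a cofiltered limit of finite ones. -/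
lemma exists_presentation (P : ProMA.{u}) :
    ∃ (J : Type u) (_ : SmallCategory J) (_ : IsCofiltered J) (F : J ⥤ FinModalAlg.{u})
      (c : Cone (F ⋙ FinModalAlg.toPro)) (_ : IsLimit c), c.pt = P := by
  obtain ⟨B, J, _, _, F, c, ⟨hc⟩, rfl⟩ := P
  let c' : Cone (F ⋙ FinModalAlg.toPro) :=
    { pt := ⟨c.pt, J, inferInstance, inferInstance, F, c, ⟨hc⟩, rfl⟩
      π :=
        { app j := ⟨c.π.app j⟩
          naturality _ _ t := ObjectProperty.hom_ext _ (c.π.naturality t) } }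
  have hc' : IsLimit (toCAMACone c') := hc
  exact ⟨J, inferInstance, inferInstance, F, c', isLimitOfToCAMACone hc', rfl⟩

lemma hasLimit (F : J ⥤ FinModalAlg.{u}) : HasLimit (F ⋙ FinModalAlg.toPro) :=
  ⟨⟨limitCone F, isLimitOfToCAMACone (CAMA.isConcreteLimit_limitCone _).isLimit⟩⟩

/-- The inclusion into modal algebras preserves cofiltered limits of finite algebras. -/
noncomputable def isLimitInclMapCone {c : Cone (F ⋙ FinModalAlg.toPro)} (hc : IsLimit c) :
    IsLimit (ProMA.incl.mapCone c) :=
  (isConcreteLimit_of_isLimit hc).isLimitMapCone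

end ProMA

/-! ### The category of finite models and its surjective part. -/

namespace ModalAlg

variable {A : ModalAlg.{u}}

/-- The finite `A`-model given by a morphism to a finite modal algebra. -/
def FiniteModel.mk (C : FinModalAlg.{u}) (f : A ⟶ C.obj) : FiniteModel A :=
  StructuredArrow.mk (S := A) (T := FinModalAlg.incl.{u}) (Y := C) f

/-- Morphisms of finite `A`-models are morphisms of algebras under `A`. -/
def FiniteModel.homMk {X Y : FiniteModel A} (g : X.right.obj ⟶ Y.right.obj)
    (hg : X.hom ≫ g = Y.hom) : X ⟶ Y :=
  StructuredArrow.homMk ⟨g⟩ hg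

/-- Surjections are epimorphisms; in particular the surjective models form a thin category. -/
lemma FiniteModel.hom_ext {X Y : FiniteModel A} (hX : A.IsIrreducible X) (f g : X ⟶ Y) :
    f = g := by
  refine StructuredArrow.ext _ _ (ObjectProperty.hom_ext _ ?_)
  exact eq_of_comp_eq_of_surjective (f := X.hom) hX
    ((StructuredArrow.w f).trans (StructuredArrow.w g).symm)

lemma FiniteModel.exists_irreducible (X Y : FiniteModel A) :
    ∃ Z, A.IsIrreducible Z ∧ Nonempty (Z ⟶ X) ∧ Nonempty (Z ⟶ Y) := by
  have : Finite (FinModalAlg.incl.obj X.right) := X.right.property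
  have : Finite (FinModalAlg.incl.obj Y.right) := Y.right.property
  obtain ⟨D, hD, e, p, q, he, hp, hq⟩ := exists_surjective_factorization X.hom Y.hom
  exact ⟨FiniteModel.mk ⟨D, hD⟩ e, he, ⟨FiniteModel.homMk p hp⟩, ⟨FiniteModel.homMk q hq⟩⟩

lemma FiniteModel.exists_hom_of_ker_le {X Y : FiniteModel A} (hX : A.IsIrreducible X)
    (h : ∀ a b, fn X.hom a = fn X.hom b → fn Y.hom a = fn Y.hom b) : Nonempty (X ⟶ Y) := by
  obtain ⟨g, hg⟩ := exists_hom_of_fibers (𝟙 _) X.hom Y.hom hX h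
  exact ⟨FiniteModel.homMk g (ModalAlg.hom_ext fun a => hg _ a rfl)⟩

variable (A)

lemma isCofiltered_irreducible : IsCofiltered A.IsIrreducible.FullSubcategory where
  cone_objs X Y := by
    obtain ⟨Z, hZ, ⟨f⟩, ⟨g⟩⟩ := FiniteModel.exists_irreducible X.obj Y.obj
    exact ⟨⟨Z, hZ⟩, ⟨f⟩, ⟨g⟩, ⟨⟩⟩
  cone_maps X Y f g :=
    ⟨X, 𝟙 X, congrArg _ (ObjectProperty.hom_ext _ (FiniteModel.hom_ext X.property f.hom g.hom))⟩
  nonempty := by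
    have : Finite trivial.{u} := inferInstanceAs (Finite PUnit)
    let f : A ⟶ trivial.{u} := ModalAlg.homMk (fun _ => PUnit.unit) (fun _ _ => rfl)
      (fun _ _ => rfl) rfl rfl (fun _ => rfl)
    exact ⟨⟨FiniteModel.mk ⟨trivial, this⟩ f, fun _ => ⟨⊥, rfl⟩⟩⟩

lemma initial_irreducible : A.IsIrreducible.ι.Initial := by
  have := isCofiltered_irreducible A
  refine Functor.initial_of_exists_of_isCofiltered _ (fun X => ?_) fun {X Y} f g => ?_
  · obtain ⟨Z, hZ, ⟨f⟩, -⟩ := FiniteModel.exists_irreducible X X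
    exact ⟨⟨Z, hZ⟩, ⟨f⟩⟩
  · exact ⟨Y, 𝟙 Y, congrArg _ (FiniteModel.hom_ext Y.property f g)⟩

/-- Up to isomorphism, a surjective model is determined by its kernel relation, and the relations on
`A` form a small type. -/
lemma essentiallySmall_irreducible : EssentiallySmall.{u} A.IsIrreducible.FullSubcategory := by
  refine (essentiallySmall_iff _).2 ⟨?_, inferInstance⟩
  let E := (fromSkeleton A.IsIrreducible.FullSubcategory).obj
  let ker (X : Skeleton A.IsIrreducible.FullSubcategory) (a b : A) : Prop :=
    fn (E X).obj.hom a = fn (E X).obj.hom b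
  refine small_of_injective (f := ker) fun X Y h => ?_
  have h' : ∀ a b, fn (E X).obj.hom a = fn (E X).obj.hom b ↔
      fn (E Y).obj.hom a = fn (E Y).obj.hom b := fun a b =>
    iff_of_eq (congrFun (congrFun h a) b)
  obtain ⟨f⟩ := FiniteModel.exists_hom_of_ker_le (E X).property fun a b => (h' a b).1
  obtain ⟨g⟩ := FiniteModel.exists_hom_of_ker_le (E Y).property fun a b => (h' a b).2
  let i : E X ≅ E Y :=
    { hom := ⟨f⟩
      inv := ⟨g⟩
      hom_inv_id := ObjectProperty.hom_ext _ (FiniteModel.hom_ext (E X).property _ _)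
      inv_hom_id := ObjectProperty.hom_ext _ (FiniteModel.hom_ext (E Y).property _ _) }
  exact skeleton_skeletal _ ⟨(fromSkeleton _).preimageIso i⟩

/-- There is a small cofiltered initial category of finite `A`-models, all of them surjective. -/
lemma exists_small_initial : ∃ (J : Type u) (_ : SmallCategory J) (_ : IsCofiltered J)
    (Φ : J ⥤ FiniteModel A), Φ.Initial ∧ ∀ j, A.IsIrreducible (Φ.obj j) := by
  have := essentiallySmall_irreducible A
  have := isCofiltered_irreducible A
  have := initial_irreducible A
  let e := equivSmallModel.{u} A.IsIrreducible.FullSubcategory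
  exact ⟨SmallModel.{u} A.IsIrreducible.FullSubcategory, inferInstance,
    IsCofiltered.of_equivalence e, e.inverse ⋙ A.IsIrreducible.ι, inferInstance,
    fun j => (e.inverse.obj j).property⟩

lemma hasLimit_modelDiagram : HasLimit A.modelDiagram := by
  obtain ⟨J, _, _, Φ, _, -⟩ := exists_small_initial A
  have : HasLimit (Φ ⋙ A.modelDiagram) :=
    ProMA.hasLimit (Φ ⋙ StructuredArrow.proj A FinModalAlg.incl)
  exact Functor.Initial.hasLimit_of_comp Φ

/-! ### The universal property of the limit of finite models. -/

variable {A}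

lemma nonempty_isLimit_incl_mapCone {c : Cone A.modelDiagram} (hc : IsLimit c) :
    Nonempty (IsLimit (ProMA.incl.mapCone c)) := by
  obtain ⟨J, _, _, Φ, _, -⟩ := exists_small_initial A
  have h : IsLimit (c.whisker Φ) := (Functor.Initial.isLimitWhiskerEquiv Φ c).symm hc
  have h' := ProMA.isLimitInclMapCone
    (F := Φ ⋙ StructuredArrow.proj A FinModalAlg.incl) (c := c.whisker Φ) h
  exact ⟨Functor.Initial.isLimitWhiskerEquiv Φ (ProMA.incl.mapCone c) h'⟩

/-- The morphism from `A` to the limit of its finite models is universal among morphisms to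
profinite modal algebras. -/
lemma existsUnique_lift {c : Cone A.modelDiagram} (hc : IsLimit c) {η : A ⟶ ProMA.incl.obj c.pt}
    (hη : ∀ X : FiniteModel A, η ≫ ProMA.incl.map (c.π.app X) = X.hom)
    {P : ProMA.{u}} (g : A ⟶ ProMA.incl.obj P) :
    ∃! h : c.pt ⟶ P, η ≫ ProMA.incl.map h = g := by
  obtain ⟨K, _, _, F, d, hd, rfl⟩ := ProMA.exists_presentation P
  have hd' := ProMA.isLimitInclMapCone hd
  refine existsUnique_of_exists_of_unique ?_ fun h₁ h₂ e₁ e₂ => hd.hom_ext fun k => ?_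
  -- Composing `g` with the projections of `P` gives finite models, and the projections of `c` at
  -- these models form a cone inducing the lift.
  · let X (k : K) : FiniteModel A := StructuredArrow.mk (S := A) (T := FinModalAlg.incl.{u})
      (Y := F.obj k) (g ≫ ProMA.incl.map (d.π.app k))
    let m {k l : K} (t : k ⟶ l) : X k ⟶ X l := StructuredArrow.homMk (F.map t) (by
      change (g ≫ ProMA.incl.map (d.π.app k)) ≫
        ProMA.incl.map ((F ⋙ FinModalAlg.toPro).map t) = g ≫ ProMA.incl.map (d.π.app l)
      rw [Category.assoc, ← Functor.map_comp, d.w])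
    let s : Cone (F ⋙ FinModalAlg.toPro) :=
      { pt := c.pt
        π :=
          { app k := c.π.app (X k)
            naturality _ _ t := (Category.id_comp _).trans (c.w (m t)).symm } }
    refine ⟨hd.lift s, hd'.hom_ext fun k => ?_⟩
    change (η ≫ ProMA.incl.map (hd.lift s)) ≫ ProMA.incl.map (d.π.app k) =
      g ≫ ProMA.incl.map (d.π.app k)
    rw [Category.assoc, ← Functor.map_comp, hd.fac]
    exact hη (X k)
  -- Both composites to `F.obj k` factor through a single surjective model, by `v₁` and `v₂`. These
  -- agree after precomposition with the surjection from `A`, hence are equal.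
  · obtain ⟨J, _, _, Φ, _, hΦ⟩ := exists_small_initial A
    have hw : IsLimit (c.whisker Φ) := (Functor.Initial.isLimitWhiskerEquiv Φ c).symm hc
    obtain ⟨j, v₁, v₂, hv₁, hv₂⟩ := ProMA.exists_common_factorization
      (F := Φ ⋙ StructuredArrow.proj A FinModalAlg.incl) hw (h₁ ≫ d.π.app k) (h₂ ≫ d.π.app k)
    have key : ∀ (h : c.pt ⟶ d.pt) (v : (Φ.obj j).right ⟶ F.obj k),
        η ≫ ProMA.incl.map h = g →
        (c.whisker Φ).π.app j ≫ FinModalAlg.toPro.map v = h ≫ d.π.app k →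
        (Φ.obj j).hom ≫ FinModalAlg.incl.map v = g ≫ ProMA.incl.map (d.π.app k) :=
      fun h v hh hv => calc
        (Φ.obj j).hom ≫ FinModalAlg.incl.map v =
            (η ≫ ProMA.incl.map (c.π.app (Φ.obj j))) ≫ FinModalAlg.incl.map v :=
          congrArg (· ≫ FinModalAlg.incl.map v) (hη (Φ.obj j)).symm
        _ = η ≫ ProMA.incl.map (h ≫ d.π.app k) :=
          congrArg (fun m => η ≫ ProMA.incl.map m) hv
        _ = (η ≫ ProMA.incl.map h) ≫ ProMA.incl.map (d.π.app k) := rfl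
        _ = g ≫ ProMA.incl.map (d.π.app k) := congrArg (· ≫ ProMA.incl.map (d.π.app k)) hh
    have hv : v₁ = v₂ := ObjectProperty.hom_ext _ (eq_of_comp_eq_of_surjective (hΦ j)
      ((key h₁ v₁ e₁ hv₁).trans (key h₂ v₂ e₂ hv₂).symm))
    exact hv₁.symm.trans ((congrArg (fun v => _ ≫ FinModalAlg.toPro.map v) hv).trans hv₂)

lemma exists_iso_limit {c : Cone A.modelDiagram} (hc : IsLimit c) {η : A ⟶ ProMA.incl.obj c.pt}
    (hη : ∀ X : FiniteModel A, η ≫ ProMA.incl.map (c.π.app X) = X.hom)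
    {PrC : ModalAlg.{u} ⥤ ProMA.{u}} (adj : PrC ⊣ ProMA.incl) :
    ∃ i : PrC.obj A ≅ c.pt, adj.unit.app A ≫ ProMA.incl.map i.hom = η := by
  let f : PrC.obj A ⟶ c.pt := (adj.homEquiv _ _).symm η
  have hf : adj.unit.app A ≫ ProMA.incl.map f = η :=
    (adj.homEquiv_unit _ _ _).symm.trans ((adj.homEquiv _ _).apply_symm_apply η)
  obtain ⟨g, hg, -⟩ := existsUnique_lift hc hη (adj.unit.app A)
  refine ⟨⟨f, g, (adj.homEquiv _ _).injective ?_, ?_⟩, hf⟩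
  · rw [adj.homEquiv_unit, adj.homEquiv_unit, Functor.map_comp, ← Category.assoc, hf,
      CategoryTheory.Functor.map_id]
    exact hg.trans (Category.comp_id _).symm
  · refine (existsUnique_lift hc hη η).unique ?_ ?_
    · rw [Functor.map_comp, ← Category.assoc]
      exact (congrArg (· ≫ ProMA.incl.map f) hg).trans hf
    · rw [CategoryTheory.Functor.map_id, Category.comp_id]

end ModalAlg

/-- By the universal property, the map from `A` to the limit of its finite models is initial in the
comma category of arrows from `A` to `ι`. -/
lemma ProMA.isRightAdjoint_incl : ProMA.incl.{u}.IsRightAdjoint := by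
  refine isRightAdjoint_iff_hasInitial_structuredArrow.2 fun A => ?_
  have := hasLimit_modelDiagram A
  have hc := limit.isLimit A.modelDiagram
  obtain ⟨hc'⟩ := nonempty_isLimit_incl_mapCone hc
  have key {P : ProMA.{u}} (g : A ⟶ ProMA.incl.obj P) :=
    existsUnique_lift hc (hc'.fac A.modelCone) g
  let X : StructuredArrow A ProMA.incl := StructuredArrow.mk (hc'.lift A.modelCone)
  refine IsInitial.hasInitial (X := X) (IsInitial.ofUniqueHom
    (fun Y => StructuredArrow.homMk (key Y.hom).choose (key Y.hom).choose_spec.1) fun Y m => ?_)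
  exact StructuredArrow.ext _ _ ((key Y.hom).choose_spec.2 _ (StructuredArrow.w m))

/-! ### The pro-completion, by dualizing the ind-completion criterion. -/

namespace FinModalAlg

instance : FinModalAlg.toPro.{u}.Full where
  map_surjective g := ⟨⟨g.hom.hom⟩, rfl⟩

instance : FinModalAlg.toPro.{u}.Faithful where
  map_injective h := ObjectProperty.hom_ext _ (congrArg (fun k => k.hom.hom) h)

lemma isCompactValued_toPro_op : FinModalAlg.toPro.{u}.op.IsCompactValued where
  exists_factorization {J _ _ F c} hc X h := by
    obtain ⟨k, g, hg⟩ := ProMA.exists_factorization (F := F.leftOp)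
      (c := coneLeftOpOfCocone c) (isLimitConeLeftOpOfCocone _ hc) h.unop
    exact ⟨k.unop, g.op, Quiver.Hom.unop_inj hg⟩
  exists_comp_eq {J _ _ F c} hc X j f g h := by
    obtain ⟨k, t, ht⟩ := ProMA.exists_comp_eq (F := F.leftOp) (c := coneLeftOpOfCocone c)
      (isLimitConeLeftOpOfCocone _ hc) (j := op j) (f := f.unop) (g := g.unop)
      (Quiver.Hom.op_inj h)
    exact ⟨k.unop, t.unop, Quiver.Hom.unop_inj ht⟩

end FinModalAlg

lemma ProMA.exists_equivalence_ind :
    ∃ e : ProMA.{u} ≌ (Ind FinModalAlg.{u}ᵒᵖ)ᵒᵖ,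
      Nonempty (FinModalAlg.toPro ⋙ e.functor ≅
        (Ind.yoneda (C := FinModalAlg.{u}ᵒᵖ)).rightOp) := by
  have hpres (P : ProMA.{u}ᵒᵖ) : ∃ (J : Type u) (_ : SmallCategory J) (_ : IsFiltered J)
      (F : J ⥤ FinModalAlg.{u}ᵒᵖ) (c : Cocone (F ⋙ FinModalAlg.toPro.op)) (_ : IsColimit c),
      c.pt = P := by
    obtain ⟨J, _, _, F, c, hc, h⟩ := ProMA.exists_presentation P.unop
    exact ⟨Jᵒᵖ, inferInstance, inferInstance, F.op, c.op, hc.op, congrArg op h⟩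
  have hcolim (J : Type u) [SmallCategory J] [IsFiltered J] (F : J ⥤ FinModalAlg.{u}ᵒᵖ) :
      HasColimit (F ⋙ FinModalAlg.toPro.op) := by
    have : HasLimit (F ⋙ FinModalAlg.toPro.op).leftOp := ProMA.hasLimit F.leftOp
    exact hasColimit_of_hasLimit_leftOp _
  obtain ⟨e, ⟨i⟩⟩ := FinModalAlg.isCompactValued_toPro_op.{u}.exists_equivalence_ind hpres hcolim
  -- Passing to opposites reverses the components of `i`, so their inverses are used.
  exact ⟨e.rightOp, ⟨NatIso.ofComponents (fun X => (i.app (op X)).symm.op) fun f =>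
    Quiver.Hom.unop_inj (i.inv.naturality f.op).symm⟩⟩

theorem mainTheorem5 :
    -- profinite modal algebras form the pro-completion of the category of finite modal algebras
    (∃ e : ProMA.{u} ≌ (Ind FinModalAlg.{u}ᵒᵖ)ᵒᵖ,
      Nonempty (FinModalAlg.toPro ⋙ e.functor ≅
        (Ind.yoneda (C := FinModalAlg.{u}ᵒᵖ)).rightOp)) ∧
    -- the inclusion has a left adjoint
    ProMA.incl.{u}.IsRightAdjoint ∧
    ∀ A : ModalAlg.{u},
      -- the limit of the diagram of finite models exists
      HasLimit (ModalAlg.modelDiagram A) ∧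
      -- the irreducible models form a cofiltered initial part of it
      IsCofiltered (ModalAlg.IsIrreducible A).FullSubcategory ∧
      (ModalAlg.IsIrreducible A).ι.Initial ∧
      ∀ (c : Cone (ModalAlg.modelDiagram A)) (_ : IsLimit c),
        Nonempty (IsLimit (c.whisker (ModalAlg.IsIrreducible A).ι)) ∧
        -- the inclusion preserves the limit, and for every left adjoint the unit at `A` is,
        -- up to an isomorphism with the limit, the induced map from `A` into the limit
        ∃ hc : IsLimit (ProMA.incl.mapCone c),
          ∀ (PrC : ModalAlg.{u} ⥤ ProMA.{u}) (adj : PrC ⊣ ProMA.incl),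
            ∃ i : PrC.obj A ≅ c.pt,
              adj.unit.app A ≫ ProMA.incl.map i.hom = hc.lift (ModalAlg.modelCone A) := by
  refine ⟨ProMA.exists_equivalence_ind, ProMA.isRightAdjoint_incl, fun A =>
    ⟨hasLimit_modelDiagram A, isCofiltered_irreducible A, initial_irreducible A, fun c hc => ?_⟩⟩
  have := initial_irreducible A
  obtain ⟨hc'⟩ := nonempty_isLimit_incl_mapCone hc
  exact ⟨⟨(Functor.Initial.isLimitWhiskerEquiv A.IsIrreducible.ι c).symm hc⟩, hc',
    fun PrC adj => exists_iso_limit hc (hc'.fac A.modelCone) adj⟩
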